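/- Let $(\Omega,\mathcal F,P)$ be a probability space and let $X:\Omega\to\mathbb R^{n_x}$, $Y:\Omega\to\mathbb R^{n_y}$ be random vectors with joint law $P_{XY}$ and marginal law $P_X$ of $X$; let $T(dy\,|\,x)$ be the (regular) conditional distribution of $Y$ given $X=x$. A multifunction $\hat\partial h:\mathbb R^n\rightrightarrows\mathbb R^n$ is called a generalized subdifferential mapping of $h:\mathbb R^n\to\mathbb R$ if it is upper semicontinuous with nonempty, convex, compact values and, for every $x$, $$\lim_{y\to x,\;y\neq x}\ \sup_{g\in\hat\partial h(y)}\frac{|h(y)-h(x)-\langle g,y-x\rangle|}{\|y-x\|}=0 .$$ If such a mapping exists, $h$ is called differentiable in the generalized sense. A function $h:\mathbb R^n\to\mathbb R^m$ is differentiable in the generalized sense if each of its components is, and then $\hat\partial h(x)$ denotes the set of all $n\times m$ matrices whose $j$-th column belongs to $\hat\partial h_j(x)$, $j=1,\dots,m$. Let $f:\mathbb R^{n_x}\times\mathbb R^{n_y}\times\mathbb R^{n_\beta}\to\mathbb R^{n_f}$ be such that $f(X,Y,\beta)$ is integrable for every $\beta$ (that is, $f(\cdot,\cdot,\beta)$ is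 $P_{XY}$-integrable). Suppose that $f(x,y,\cdot)$ is differentiable in the generalized sense for $P_{XY}$-almost all $(x,y)$, with generalized subdifferentials $\hat\partial_\beta f_j(x,y,\beta)$, $j=1,\dots,n_f$, and that for all $\beta$ and $j$ the multifunction $(x,y)\mapsto\hat\partial_\beta f_j(x,y,\beta)$ is Borel measurable (the set of all $(x,y)$ at which its value meets a given open set is Borel). Suppose further that for every $\beta_0$ and every bounded neighborhood $K$ of $\beta_0$ there is a $P_{XY}$-integrable function $L_K$ such that, for $P_{XY}$-almost all $(x,y)$, $\|g\|\le L_K(x,y)$ for all $\beta\in K$, all $j$ and all $g\in\hat\partial_\beta f_j(x,y,\beta)$. Put $F(x,\beta)=\int f(x,y,\beta)\,T(dy\,|\,x)$, and let $\hat\partial_\beta F_j(x,\beta)=\int\hat\partial_\beta f_j(x,y,\beta)\,T(dy\,|\,x)$ be the set of integrals of all integrable measurable selections of $y\mapsto\hat\partial_\beta f_j(x,y,\beta)$ (selections up to $T(\cdot\,|\,x)$-null sets). Then: 1. $F(X,\beta)=\mathbb E[f(X,Y,\beta)\,|\,X]$ a.s. for every $\beta$. 2. For $P_X$-almost every $x$,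 the function $f(x,\cdot,\beta)$ is $T(\cdot\,|\,x)$-integrable for every $\beta$, and $\beta\mapsto F(x,\beta)$ is differentiable in the generalized sense, with generalized subdifferential mappings $\hat\partial_\beta F_j(x,\cdot)$ of its components, $j=1,\dots,n_f$. 3. For every $\beta$ and every measurable function $s$ on $\mathbb R^{n_x}\times\mathbb R^{n_y}$ with values in the $n_\beta\times n_f$ matrices such that $s(X,Y)\in\hat\partial_\beta f(X,Y,\beta)$ a.s., the random matrix $s(X,Y)$ is integrable and $$\mathbb E[s(X,Y)\,|\,X]\in\hat\partial_\beta F(X,\beta)\quad\text{a.s.},$$ where $\hat\partial_\beta F(x,\beta)$ is the set of matrices whose $j$-th column belongs to $\hat\partial_\beta F_j(x,\beta)$. -/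

import Mathlib

open MeasureTheory ProbabilityTheory Filter Topology

/-- Column vectors of dimension `n` with the Euclidean norm. -/
abbrev Vec (n : ℕ) : Type := EuclideanSpace ℝ (Fin n)

/-- `D` is a generalized subdifferential mapping (in the sense of Norkin) of the scalar function
`h : ℝⁿ → ℝ`: a nonempty, convex, compact valued and upper semicontinuous multifunction such that
`h y = h x + ⟪g, y - x⟫ + o(x, y, g)` with `sup_{g ∈ D y} |o(x, y, g)| / ‖y - x‖ → 0` as `y → x`,
at every point `x`. -/
structure IsGeneralizedSubdifferential {n : ℕ} (h : Vec n → ℝ) (D : Vec n → Set (Vec n)) :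
    Prop where
  nonempty : ∀ x, (D x).Nonempty
  convex : ∀ x, Convex ℝ (D x)
  compact : ∀ x, IsCompact (D x)
  upperSemicontinuous : UpperHemicontinuous D
  expansion : ∀ x, ∀ ε : ℝ, 0 < ε → ∀ᶠ y in 𝓝 x, ∀ g ∈ D y,
    |h y - h x - inner ℝ g (y - x)| ≤ ε * ‖y - x‖

/-- The vector version: for `h : ℝⁿ → ℝᵐ`, `D x j` is the generalized subdifferential at `x` of the
`j`-th component of `h`. -/
def IsGeneralizedSubdifferentialVec {n m : ℕ} (h : Vec n → Vec m)
    (D : Vec n → Fin m → Set (Vec n)) : Prop :=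
  ∀ j, IsGeneralizedSubdifferential (fun x => h x j) (fun x => D x j)

/-- The `n × m` matrices, given by their columns, whose `j`-th column belongs to `D j`. -/
def jacobianSet {n m : ℕ} (D : Fin m → Set (Vec n)) : Set (Fin m → Vec n) :=
  {M | ∀ j, M j ∈ D j}

/-- A set-valued map is measurable if the preimage (by hitting) of every open set is measurable. -/
def MeasurableMultifunction {S : Type*} [MeasurableSpace S] {n : ℕ} (D : S → Set (Vec n)) : Prop :=
  ∀ U : Set (Vec n), IsOpen U → MeasurableSet {p | (D p ∩ U).Nonempty}

/-- The (Aumann) integral of a set-valued map: the set of the integrals of all its integrable measurable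
selections. -/
def aumannIntegral {S : Type*} [MeasurableSpace S] {n : ℕ} (μ : Measure S) (D : S → Set (Vec n)) :
    Set (Vec n) :=
  {v | ∃ s : S → Vec n, Measurable s ∧ (∀ᵐ y ∂μ, s y ∈ D y) ∧ Integrable s μ ∧ ∫ y, s y ∂μ = v}

/-- `F(x, β) = 𝔼[f(X, Y, β) | X = x] = ∫ f(x, y, β) T(dy | x)`, where `T` is the conditional
distribution of `Y` given `X`. -/
noncomputable def condMean {nx ny nb nf : ℕ} (T : Kernel (Vec nx) (Vec ny))
    (f : Vec nx → Vec ny → Vec nb → Vec nf) (x : Vec nx) (β : Vec nb) : Vec nf :=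
  ∫ y, f x y β ∂(T x)

/-- The conditional expectation `𝔼[D(X, Y, β) | X = x]` of a family of (componentwise)
subdifferentials: the integral of the set-valued map `y ↦ D(x, y, β)` with respect to
`T(dy | x)`. -/
def condSubdifferential {nx ny nb nf : ℕ} (T : Kernel (Vec nx) (Vec ny))
    (D : Vec nx → Vec ny → Vec nb → Fin nf → Set (Vec nb)) (x : Vec nx) (β : Vec nb) (j : Fin nf) :
    Set (Vec nb) :=
  aumannIntegral (T x) (fun y => D x y β j)

/-! Disintegrating the joint law along T(dy|x) reduces differentiability to a fixed x: integrating
generalized subdifferentials over a finite measure, with integrable bounds on balls, yields a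
generalized subdifferential of the integral (`isGeneralizedSubdifferential_integral`).

Expansion: subgradient bounds make the integrands Lipschitz, so the normalized remainders along any
selections are dominated by 2L. They tend to 0 for almost every y, because the pointwise expansion
is uniform over subgradients; dominated convergence concludes.

Compactness and upper semicontinuity rest on a closed graph property
(`mem_aumannIntegral_of_tendsto`): a limit of integrals of selections at b k → x is the integral of
a selection at x. A projection argument in L² stands in for weak compactness; it finds a function
with the limiting integral and values in the closed convex hulls of all tails, hence in the value at
x. Nonemptiness comes from the measurable selection of minimal norm.

The other two claims follow from computing conditional expectations by integration against the
conditional distribution: sections of a selection are selections. -/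

/-! ### Limits of integrals of selections -/

/-- In a real Hilbert space, a decreasing sequence of nonempty bounded closed convex sets has a
common point. -/
theorem exists_mem_forall_of_antitone_convex {H : Type*} [NormedAddCommGroup H]
    [InnerProductSpace ℝ H] [CompleteSpace H] {C : ℕ → Set H} (hC : Antitone C)
    (hne : ∀ m, (C m).Nonempty) (hcl : ∀ m, IsClosed (C m)) (hcv : ∀ m, Convex ℝ (C m))
    {R : ℝ} (hR : ∀ u ∈ C 0, ‖u‖ ≤ R) : ∃ u, ∀ m, u ∈ C m := by
  choose p hp hpmin using fun m =>
    exists_norm_eq_iInf_of_complete_convex (hne m) (hcl m).isComplete (hcv m) 0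
  have hin : ∀ m, ∀ w ∈ C m, ‖p m‖ ^ 2 ≤ inner ℝ (p m) w := by
    intro m w hw
    have := (norm_eq_iInf_iff_real_inner_le_zero (hcv m) (hp m)).1 (hpmin m) w hw
    rw [zero_sub, inner_neg_left, inner_sub_right, real_inner_self_eq_norm_sq] at this
    linarith
  -- Distances are controlled by increments of squared norms, which increase and stay bounded; hence
  -- the minimal points form a Cauchy sequence.
  have hdist : ∀ n m, n ≤ m → ‖p m - p n‖ ^ 2 ≤ ‖p m‖ ^ 2 - ‖p n‖ ^ 2 := by
    intro n m hnm
    have h1 := hin n (p m) (hC hnm (hp m))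
    rw [norm_sub_sq_real, real_inner_comm]
    linarith
  have hmono : Monotone fun m => ‖p m‖ ^ 2 := by
    intro n m hnm
    have := hdist n m hnm
    have := sq_nonneg ‖p m - p n‖
    simp only
    linarith
  have hbdd : BddAbove (Set.range fun m => ‖p m‖ ^ 2) := by
    refine ⟨R ^ 2, ?_⟩
    rintro _ ⟨m, rfl⟩
    exact pow_le_pow_left₀ (norm_nonneg _) (hR _ (hC (Nat.zero_le m) (hp m))) 2
  have hlim := tendsto_atTop_ciSup hmono hbdd
  have hcauchy : CauchySeq p := by
    refine Metric.cauchySeq_iff'.2 fun ε hε => ?_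
    obtain ⟨N, hN⟩ := Metric.cauchySeq_iff'.1 hlim.cauchySeq (ε ^ 2) (by positivity)
    refine ⟨N, fun n hn => ?_⟩
    have h1 := hN n hn
    rw [Real.dist_eq] at h1
    rw [dist_eq_norm]
    exact lt_of_pow_lt_pow_left₀ 2 hε.le
      ((hdist N n hn).trans_lt ((le_abs_self _).trans_lt h1))
  obtain ⟨u, hu⟩ := cauchySeq_tendsto_of_complete hcauchy
  refine ⟨u, fun m => (hcl m).mem_of_tendsto hu ?_⟩
  filter_upwards [eventually_ge_atTop m] with k hk using hC hk (hp k)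

/-- Limits of integrals of dominated functions `s k ∈ E k`, where the sets `E k y` are closed,
convex and decreasing, are integrals of functions with values in `⋂ k, E k y`. -/
theorem exists_measurable_integral_eq_of_tendsto {S V : Type*} [MeasurableSpace S] {ν : Measure S}
    [IsFiniteMeasure ν] [NormedAddCommGroup V] [InnerProductSpace ℝ V] [CompleteSpace V]
    [MeasurableSpace V] [BorelSpace V] [SecondCountableTopology V]
    {W : S → ℝ} (hW : Integrable W ν) (hW0 : ∀ y, 0 < W y)
    {s : ℕ → S → V} (hs : ∀ k, AEStronglyMeasurable (s k) ν)
    (hsW : ∀ k, ∀ᵐ y ∂ν, ‖s k y‖ ≤ W y)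
    {E : ℕ → S → Set V} (hE : ∀ y, Antitone fun k => E k y) (hEcl : ∀ k y, IsClosed (E k y))
    (hEcv : ∀ k y, Convex ℝ (E k y)) (hsE : ∀ k, ∀ᵐ y ∂ν, s k y ∈ E k y)
    {v : V} (hv : Tendsto (fun k => ∫ y, s k y ∂ν) atTop (𝓝 v)) :
    ∃ t : S → V, Measurable t ∧ (∀ᵐ y ∂ν, ∀ k, t y ∈ E k y) ∧ Integrable t ν ∧
      ∫ y, t y ∂ν = v := by
  have hint : ∀ u : S → V, AEStronglyMeasurable u ν → (∀ᵐ y ∂ν, ‖u y‖ ≤ 1) →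
      Integrable (fun y => W y • u y) ν := by
    intro u hu hu1
    refine hW.mono (hW.1.smul hu) ?_
    filter_upwards [hu1] with y hy
    rw [norm_smul]
    exact mul_le_of_le_one_right (norm_nonneg _) hy
  -- The supremum over the tail makes the tolerance decreasing, so that the sets `C m` below are
  -- nested.
  let δ : ℕ → ℝ := fun m => ⨆ k : {k // m ≤ k}, ‖(∫ y, s k.1 y ∂ν) - v‖
  have hnt : Tendsto (fun k => ‖(∫ y, s k y ∂ν) - v‖) atTop (𝓝 0) := by
    simpa using (hv.sub_const v).norm
  have hbdd : BddAbove (Set.range fun k => ‖(∫ y, s k y ∂ν) - v‖) := hnt.bddAbove_range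
  have hbdd' : ∀ m, BddAbove (Set.range fun k : {k // m ≤ k} => ‖(∫ y, s k.1 y ∂ν) - v‖) :=
    fun m => hbdd.mono (by rintro _ ⟨k, rfl⟩; exact ⟨k.1, rfl⟩)
  have hδle : ∀ m k, m ≤ k → ‖(∫ y, s k y ∂ν) - v‖ ≤ δ m :=
    fun m k h => le_ciSup (hbdd' m) ⟨k, h⟩
  have hδanti : Antitone δ := by
    intro m n hmn
    have : Nonempty {k // n ≤ k} := ⟨⟨n, le_rfl⟩⟩
    exact ciSup_le fun k => hδle m k (hmn.trans k.2)
  have hδ0 : ∀ r : ℝ, (∀ m, r ≤ δ m) → r ≤ 0 := by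
    intro r hr
    refine le_of_forall_pos_le_add fun ε hε => ?_
    obtain ⟨N, hN⟩ := eventually_atTop.1 (hnt.eventually_le_const hε)
    have : Nonempty {k // N ≤ k} := ⟨⟨N, le_rfl⟩⟩
    rw [zero_add]
    exact (hr N).trans (ciSup_le fun k => hN k k.2)
  -- Here `u` stands for a function divided by `W`: it is bounded by 1, hence in L², although `W` is
  -- only integrable.
  let C : ℕ → Set (Lp V 2 ν) := fun m => {u | (∀ᵐ y ∂ν, ‖u y‖ ≤ 1) ∧
    (∀ᵐ y ∂ν, W y • u y ∈ E m y) ∧ ‖(∫ y, W y • u y ∂ν) - v‖ ≤ δ m}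
  have hCanti : Antitone C := by
    rintro m n hmn u ⟨h1, h2, h3⟩
    exact ⟨h1, h2.mono fun y hy => hE y hmn hy, h3.trans (hδanti hmn)⟩
  have hCne : ∀ m, (C m).Nonempty := by
    intro m
    have hWi : AEStronglyMeasurable (fun y => (W y)⁻¹) ν :=
      hW.1.aemeasurable.inv.aestronglyMeasurable
    have hle : ∀ᵐ y ∂ν, ‖(W y)⁻¹ • s m y‖ ≤ 1 := by
      filter_upwards [hsW m] with y hy
      rw [norm_smul, norm_inv, Real.norm_of_nonneg (hW0 y).le]
      exact inv_mul_le_one_of_le₀ hy (hW0 y).le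
    have hmem : MemLp (fun y => (W y)⁻¹ • s m y) 2 ν :=
      MemLp.of_bound (hWi.smul (hs m)) 1 hle
    have hco := hmem.coeFn_toLp
    have hco' : ∀ᵐ y ∂ν, W y • hmem.toLp _ y = s m y := by
      filter_upwards [hco] with y hy
      rw [hy, smul_inv_smul₀ (hW0 y).ne']
    refine ⟨hmem.toLp _, ?_, ?_, ?_⟩
    · filter_upwards [hco, hle] with y h1 h2
      rwa [h1]
    · filter_upwards [hco', hsE m] with y h1 h2
      rwa [h1]
    · rw [integral_congr_ae hco']
      exact hδle m m le_rfl
  have hCcv : ∀ m, Convex ℝ (C m) := by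
    rintro m u ⟨hu1, hu2, hu3⟩ w ⟨hw1, hw2, hw3⟩ a b ha hb hab
    have hco : ∀ᵐ y ∂ν, (a • u + b • w : Lp V 2 ν) y = a • u y + b • w y := by
      filter_upwards [Lp.coeFn_add (a • u) (b • w), Lp.coeFn_smul a u, Lp.coeFn_smul b w]
        with y h1 h2 h3
      rw [h1, Pi.add_apply, h2, h3, Pi.smul_apply, Pi.smul_apply]
    have hco' : ∀ᵐ y ∂ν, W y • (a • u + b • w : Lp V 2 ν) y = a • W y • u y + b • W y • w y := by
      filter_upwards [hco] with y h1
      rw [h1, smul_add, smul_comm a, smul_comm b]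
    refine ⟨?_, ?_, ?_⟩
    · filter_upwards [hco, hu1, hw1] with y h1 h2 h3
      rw [h1, ← mem_closedBall_zero_iff]
      exact convex_closedBall 0 1 (by simpa using h2) (by simpa using h3) ha hb hab
    · filter_upwards [hco', hu2, hw2] with y h1 h2 h3
      rw [h1]
      exact hEcv m y h2 h3 ha hb hab
    · have hiu : Integrable (fun y => a • W y • u y) ν :=
        (hint _ (Lp.aestronglyMeasurable u) hu1).smul a
      have hiw : Integrable (fun y => b • W y • w y) ν :=
        (hint _ (Lp.aestronglyMeasurable w) hw1).smul b
      rw [integral_congr_ae hco', integral_add hiu hiw, integral_smul, integral_smul,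
        ← dist_eq_norm, ← Metric.mem_closedBall]
      exact convex_closedBall v (δ m) (by rwa [Metric.mem_closedBall, dist_eq_norm])
        (by rwa [Metric.mem_closedBall, dist_eq_norm]) ha hb hab
  have hCcl : ∀ m, IsClosed (C m) := by
    refine fun m => isClosed_of_closure_subset fun u hu => ?_
    obtain ⟨w, hw, hwu⟩ := mem_closure_iff_seq_limit.1 hu
    obtain ⟨φ, hφ, hφu⟩ := (tendstoInMeasure_of_tendsto_Lp hwu).exists_seq_tendsto_ae
    have hw1 : ∀ᵐ y ∂ν, ∀ k, ‖w k y‖ ≤ 1 := ae_all_iff.2 fun k => (hw k).1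
    have hw2 : ∀ᵐ y ∂ν, ∀ k, W y • w k y ∈ E m y := ae_all_iff.2 fun k => (hw k).2.1
    have hlim : Tendsto (fun k => ∫ y, W y • w (φ k) y ∂ν) atTop (𝓝 (∫ y, W y • u y ∂ν)) := by
      refine tendsto_integral_of_dominated_convergence W
        (fun k => hW.1.smul (Lp.aestronglyMeasurable _)) hW (fun k => ?_) ?_
      · filter_upwards [hw1] with y hy
        rw [norm_smul, Real.norm_of_nonneg (hW0 y).le]
        exact mul_le_of_le_one_right (hW0 y).le (hy _)
      · filter_upwards [hφu] with y hy using hy.const_smul _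
    refine ⟨?_, ?_, ?_⟩
    · filter_upwards [hφu, hw1] with y h1 h2
      exact le_of_tendsto h1.norm (Eventually.of_forall fun k => h2 _)
    · filter_upwards [hφu, hw2] with y h1 h2
      exact (hEcl m y).mem_of_tendsto (h1.const_smul _) (Eventually.of_forall fun k => h2 _)
    · exact le_of_tendsto (hlim.sub_const v).norm (Eventually.of_forall fun k => (hw (φ k)).2.2)
  have hCR : ∀ u ∈ C 0, ‖u‖ ≤ ν.real Set.univ ^ ((2 : ENNReal).toReal)⁻¹ * 1 :=
    fun u hu => Lp.norm_le_of_ae_bound zero_le_one hu.1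
  obtain ⟨u, hu⟩ := exists_mem_forall_of_antitone_convex hCanti hCne hCcl hCcv hCR
  have hu_int := hint _ (Lp.aestronglyMeasurable u) (hu 0).1
  have hueq := hu_int.1.ae_eq_mk
  refine ⟨hu_int.1.mk _, hu_int.1.stronglyMeasurable_mk.measurable, ?_, hu_int.congr hueq, ?_⟩
  · have h2 : ∀ᵐ y ∂ν, ∀ k, W y • u y ∈ E k y := ae_all_iff.2 fun k => (hu k).2.1
    filter_upwards [h2, hueq] with y h2 h3
    rwa [← h3]
  · rw [← integral_congr_ae hueq, ← sub_eq_zero, ← norm_le_zero_iff]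
    exact hδ0 _ fun m => (hu m).2.2

/-! ### Lipschitz bound from subgradients -/

/-- A function with a generalized subdifferential bounded by `L` on a convex set is `L`-Lipschitz
there. -/
theorem IsGeneralizedSubdifferential.abs_sub_le {n : ℕ} {h : Vec n → ℝ} {D : Vec n → Set (Vec n)}
    (hD : IsGeneralizedSubdifferential h D) {K : Set (Vec n)} (hK : Convex ℝ K) {L : ℝ}
    (hL : ∀ z ∈ K, ∀ g ∈ D z, ‖g‖ ≤ L) {a b : Vec n} (ha : a ∈ K) (hb : b ∈ K) :
    |h b - h a| ≤ L * ‖b - a‖ := by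
  have hloc : ∀ x, ∀ ε : ℝ, 0 < ε → ∀ᶠ y in 𝓝 x, y ∈ K → |h y - h x| ≤ (L + ε) * ‖y - x‖ := by
    intro x ε hε
    filter_upwards [hD.expansion x ε hε] with y hy hyK
    obtain ⟨g, hg⟩ := hD.nonempty y
    have h1 := hy g hg
    have h2 := abs_real_inner_le_norm g (y - x)
    have h3 := mul_le_mul_of_nonneg_right (hL y hyK g hg) (norm_nonneg (y - x))
    have h4 := abs_sub_abs_le_abs_sub (h y - h x) (inner ℝ g (y - x))
    linarith
  have hone : ∀ a ∈ K, ∀ b ∈ K, h b - h a ≤ L * ‖b - a‖ := by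
    intro a ha b hb
    let c : ℝ → Vec n := AffineMap.lineMap a b
    have hc : Continuous c := AffineMap.lineMap_continuous
    have hcK : ∀ t ∈ Set.Icc (0 : ℝ) 1, c t ∈ K := fun t ht => hK.lineMap_mem ha hb ht
    have hcd : ∀ t z, ‖c z - c t‖ = |z - t| * ‖b - a‖ := by
      intro t z
      have : c z - c t = (z - t) • (b - a) := by
        simp only [c, AffineMap.lineMap_apply_module]; module
      rw [this, norm_smul, Real.norm_eq_abs]
    have hcloc : ∀ t, ∀ ε : ℝ, 0 < ε → ∀ᶠ z in 𝓝 t, z ∈ Set.Icc (0 : ℝ) 1 →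
        |h (c z) - h (c t)| ≤ (L + ε) * (|z - t| * ‖b - a‖) := by
      intro t ε hε
      filter_upwards [hc.continuousAt.eventually (hloc (c t) ε hε)] with z hz hzI
      rw [← hcd]
      exact hz (hcK z hzI)
    have hcont : ContinuousOn (fun t => h (c t)) (Set.Icc 0 1) := by
      intro t ht
      rw [ContinuousWithinAt, tendsto_iff_dist_tendsto_zero]
      have hlim : Tendsto (fun z => (L + 1) * (|z - t| * ‖b - a‖)) (𝓝[Set.Icc 0 1] t) (𝓝 0) := by
        have : Continuous fun z => (L + 1) * (|z - t| * ‖b - a‖) := by fun_prop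
        simpa using (this.tendsto t).mono_left nhdsWithin_le_nhds
      refine squeeze_zero' (Eventually.of_forall fun _ => dist_nonneg) ?_ hlim
      exact eventually_nhdsWithin_iff.2 (hcloc t 1 one_pos)
    -- Comparison of slopes along the segment globalizes the local constants L + ε to the exact
    -- constant L.
    have key := image_le_of_liminf_slope_right_le_deriv_boundary (f := fun t => h (c t))
      (B := fun t => h a + L * ‖b - a‖ * t) (B' := fun _ => L * ‖b - a‖) hcont
      (by simp [c]) (by fun_prop)
      (fun t _ => by
        have := ((hasDerivAt_id t).const_mul (L * ‖b - a‖)).const_add (h a)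
        simpa using this.hasDerivWithinAt) ?_ (Set.right_mem_Icc.2 zero_le_one)
    · simp only [c, AffineMap.lineMap_apply_one, mul_one] at key
      linarith
    · intro t ht r hr
      obtain ⟨ε, hε, hεr⟩ : ∃ ε : ℝ, 0 < ε ∧ (L + ε) * ‖b - a‖ < r := by
        have hlim : Tendsto (fun ε : ℝ => (L + ε) * ‖b - a‖) (𝓝[>] 0) (𝓝 (L * ‖b - a‖)) := by
          have : Continuous fun ε : ℝ => (L + ε) * ‖b - a‖ := by fun_prop
          simpa using (this.tendsto 0).mono_left nhdsWithin_le_nhds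
        obtain ⟨ε, h1, h2⟩ := ((hlim.eventually_lt_const hr).and self_mem_nhdsWithin).exists
        exact ⟨ε, h2, h1⟩
      refine Eventually.frequently ?_
      filter_upwards [(hcloc t ε hε).filter_mono nhdsWithin_le_nhds,
        Ioo_mem_nhdsGT ht.2] with z hz hzt
      have h1 := hz ⟨ht.1.trans hzt.1.le, hzt.2.le⟩
      have hpos : 0 < z - t := sub_pos.2 hzt.1
      rw [abs_of_pos hpos] at h1
      rw [slope_def_field, div_lt_iff₀ hpos]
      have h2 := (le_abs_self _).trans h1
      have h3 := mul_lt_mul_of_pos_right hεr hpos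
      linarith
  rw [abs_sub_le_iff]
  exact ⟨hone a ha b hb, by rw [norm_sub_rev]; exact hone b hb a ha⟩

/-! ### Measurable selections -/

/-- A measurable multifunction with nonempty, closed and convex values has a measurable selection:
the point of minimal norm. -/
theorem MeasurableMultifunction.exists_measurable_selection {S : Type*} [MeasurableSpace S] {n : ℕ}
    {D : S → Set (Vec n)} (hD : MeasurableMultifunction D) (hne : ∀ y, (D y).Nonempty)
    (hcl : ∀ y, IsClosed (D y)) (hcv : ∀ y, Convex ℝ (D y)) :
    ∃ s : S → Vec n, Measurable s ∧ ∀ y, s y ∈ D y := by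
  choose p hp hpmin using fun y =>
    exists_norm_eq_iInf_of_complete_convex (hne y) (hcl y).isComplete (hcv y) 0
  have hin : ∀ y, ∀ w ∈ D y, ‖p y‖ ^ 2 + ‖w - p y‖ ^ 2 ≤ ‖w‖ ^ 2 := by
    intro y w hw
    have := (norm_eq_iInf_iff_real_inner_le_zero (hcv y) (hp y)).1 (hpmin y) w hw
    rw [zero_sub, inner_neg_left, inner_sub_right, real_inner_self_eq_norm_sq] at this
    rw [norm_sub_sq_real, real_inner_comm]
    linarith
  have hle : ∀ y, ∀ w ∈ D y, ‖p y‖ ≤ ‖w‖ := fun y w hw =>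
    (pow_le_pow_iff_left₀ (norm_nonneg _) (norm_nonneg _) two_ne_zero).1
      (by have := hin y w hw; have := sq_nonneg ‖w - p y‖; linarith)
  -- Whenever the value has a point of norm less than `q`, it has one that is also nearly within `r`
  -- of `z`. Letting `q` decrease to the minimal norm, `hin` forces these points to converge to `p
  -- y`.
  have key : ∀ z r, p ⁻¹' Metric.closedBall z r = ⋂ (m : ℕ) (q : ℚ),
      ({y | (D y ∩ Metric.ball 0 q).Nonempty}ᶜ ∪
        {y | (D y ∩ (Metric.ball z (r + 1 / ((m : ℝ) + 1)) ∩ Metric.ball 0 q)).Nonempty}) := by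
    intro z r
    ext y
    simp only [Set.mem_preimage, Set.mem_iInter, Set.mem_union, Set.mem_compl_iff,
      Set.mem_ofPred_eq]
    constructor
    · intro hy m q
      refine or_iff_not_imp_left.2 fun hq => ?_
      obtain ⟨w, hw, hwq⟩ := not_not.1 hq
      refine ⟨p y, hp y, ?_, ?_⟩
      · have : (0 : ℝ) < 1 / ((m : ℝ) + 1) := by positivity
        exact Metric.closedBall_subset_ball (by linarith) hy
      · rw [mem_ball_zero_iff] at hwq ⊢
        exact (hle y w hw).trans_lt hwq
    · intro hy
      have hx : ∀ m : ℕ, ∃ w ∈ D y, dist w z ≤ r + 1 / ((m : ℝ) + 1) ∧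
          ‖w‖ ≤ ‖p y‖ + 1 / ((m : ℝ) + 1) := by
        intro m
        have : (0 : ℝ) < 1 / ((m : ℝ) + 1) := by positivity
        obtain ⟨q, hq1, hq2⟩ := exists_rat_btwn (show ‖p y‖ < ‖p y‖ + 1 / ((m : ℝ) + 1) by linarith)
        obtain ⟨w, hw, hw1, hw2⟩ := (hy m q).resolve_left
          (not_not.2 ⟨p y, hp y, mem_ball_zero_iff.2 hq1⟩)
        exact ⟨w, hw, (Metric.mem_ball.1 hw1).le, ((mem_ball_zero_iff.1 hw2).trans hq2).le⟩
      choose w hwD hwz hwp using hx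
      have h0 : Tendsto (fun m : ℕ => 1 / ((m : ℝ) + 1)) atTop (𝓝 0) :=
        tendsto_one_div_add_atTop_nhds_zero_nat
      have hw2 : Tendsto (fun m => ‖w m - p y‖ ^ 2) atTop (𝓝 0) := by
        refine squeeze_zero (fun m => sq_nonneg _)
          (g := fun m : ℕ => (‖p y‖ + 1 / ((m : ℝ) + 1)) ^ 2 - ‖p y‖ ^ 2) (fun m => ?_) ?_
        · have := hin y _ (hwD m)
          have := pow_le_pow_left₀ (norm_nonneg _) (hwp m) 2
          linarith
        · rw [← sub_self (‖p y‖ ^ 2)]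
          simpa only [add_zero] using ((h0.const_add ‖p y‖).pow 2).sub_const (‖p y‖ ^ 2)
      have hw1 : Tendsto w atTop (𝓝 (p y)) := by
        rw [tendsto_iff_norm_sub_tendsto_zero]
        simpa [Real.sqrt_sq] using hw2.sqrt
      have := le_of_tendsto_of_tendsto' (hw1.dist tendsto_const_nhds) (h0.const_add r) hwz
      simpa using this
  refine ⟨p, ?_, hp⟩
  have hclosed : ∀ z r, MeasurableSet (p ⁻¹' Metric.closedBall z r) := by
    intro z r
    rw [key]
    exact MeasurableSet.iInter fun m => MeasurableSet.iInter fun q =>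
      (hD _ Metric.isOpen_ball).compl.union (hD _ (Metric.isOpen_ball.inter Metric.isOpen_ball))
  refine measurable_of_isOpen fun U hU => ?_
  obtain ⟨T, hT, hTU⟩ : ∃ T : Set (Vec n × ℚ), T.Countable ∧
      U = ⋃ c ∈ T, Metric.closedBall c.1 (c.2 : ℝ) := by
    obtain ⟨Q, hQc, hQd⟩ := TopologicalSpace.exists_countable_dense (Vec n)
    refine ⟨{c | c ∈ Q ×ˢ Set.univ ∧ Metric.closedBall c.1 (c.2 : ℝ) ⊆ U},
      (hQc.prod Set.countable_univ).mono fun c hc => hc.1, subset_antisymm ?_ ?_⟩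
    · intro x hx
      obtain ⟨ε, hε, hεU⟩ := Metric.isOpen_iff.1 hU x hx
      obtain ⟨q, hq0, hq⟩ := exists_rat_btwn (half_pos hε)
      obtain ⟨z, hz, hzx⟩ := hQd.exists_dist_lt x hq0
      refine Set.mem_biUnion (x := (z, q)) ⟨⟨hz, trivial⟩, ?_⟩ (Metric.mem_closedBall.2 hzx.le)
      refine fun u hu => hεU ?_
      have h1 : dist u z ≤ q := hu
      have h2 := dist_triangle u z x
      rw [dist_comm z x] at h2
      rw [Metric.mem_ball]
      linarith
    · exact Set.iUnion₂_subset fun c hc => hc.2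
  rw [hTU, Set.preimage_iUnion₂]
  exact MeasurableSet.biUnion hT fun c _ => hclosed _ _

/-- On a measurable null set containing all bad values the multifunction can be replaced by {0}
without losing measurability. -/
theorem MeasurableMultifunction.exists_measurable_ae_selection {S : Type*} [MeasurableSpace S]
    {μ : Measure S} {n : ℕ} {D : S → Set (Vec n)} (hD : MeasurableMultifunction D)
    (h : ∀ᵐ y ∂μ, (D y).Nonempty ∧ IsClosed (D y) ∧ Convex ℝ (D y)) :
    ∃ s : S → Vec n, Measurable s ∧ ∀ᵐ y ∂μ, s y ∈ D y := by
  classical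
  obtain ⟨N, hNsub, hNm, hN0⟩ := exists_measurable_superset_of_null (ae_iff.1 h)
  have hgood : ∀ y, y ∉ N → (D y).Nonempty ∧ IsClosed (D y) ∧ Convex ℝ (D y) := fun y hy =>
    not_not.1 fun hn => hy (hNsub hn)
  let D' : S → Set (Vec n) := fun y => if y ∈ N then {0} else D y
  have hD' : MeasurableMultifunction D' := by
    intro U hU
    have : {y | (D' y ∩ U).Nonempty} =
        (N ∩ {_y | (0 : Vec n) ∈ U}) ∪ (Nᶜ ∩ {y | (D y ∩ U).Nonempty}) := by
      ext y
      by_cases hy : y ∈ N <;> simp [D', hy]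
    rw [this]
    exact (hNm.inter (MeasurableSet.const _)).union (hNm.compl.inter (hD U hU))
  have hgood' : ∀ y, (D' y).Nonempty ∧ IsClosed (D' y) ∧ Convex ℝ (D' y) := by
    intro y
    by_cases hy : y ∈ N
    · simp [D', hy]
    · simpa [D', hy] using hgood y hy
  obtain ⟨s, hs, hsD⟩ := hD'.exists_measurable_selection (fun y => (hgood' y).1)
    (fun y => (hgood' y).2.1) (fun y => (hgood' y).2.2)
  refine ⟨s, hs, ?_⟩
  filter_upwards [measure_eq_zero_iff_ae_notMem.1 hN0] with y hy
  simpa [D', hy] using hsD y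

/-! ### Closed graph and compactness of the Aumann integral -/

/-- Closed graph property: a point in the closed convex hulls of all the tails of `D (b k)`, where
`b k → x` and `D` is upper semicontinuous at `x`, belongs to `D x`. -/
theorem UpperHemicontinuousAt.mem_of_forall_mem_closure_convexHull {X V : Type*}
    [TopologicalSpace X] [NormedAddCommGroup V] [NormedSpace ℝ V] {D : X → Set V} {x : X}
    (hD : UpperHemicontinuousAt D x) (hcl : IsClosed (D x)) (hcv : Convex ℝ (D x)) {b : ℕ → X}
    (hb : Tendsto b atTop (𝓝 x)) {v : V}
    (hv : ∀ m, v ∈ closure (convexHull ℝ (⋃ k ≥ m, D (b k)))) : v ∈ D x := by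
  rw [← hcl.closure_eq, Metric.closure_eq_iInter_cthickening]
  refine Set.mem_iInter₂.2 fun ε hε => ?_
  -- Tails eventually lie in the ε-thickening of `D x`, which is convex, so their closed hulls lie
  -- in the closed thickening.
  have hev := hb.eventually (upperHemicontinuousAt_iff_forall_isOpen.1 hD _
    (Metric.isOpen_thickening (δ := ε)) (Metric.self_subset_thickening hε _))
  obtain ⟨m, hm⟩ := eventually_atTop.1 hev
  refine closure_minimal ?_ Metric.isClosed_cthickening (hv m)
  refine (convexHull_min ?_ (hcv.thickening ε)).trans (Metric.thickening_subset_cthickening _ _)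
  exact Set.iUnion₂_subset hm

theorem integrable_of_ae_mem_of_norm_le {S : Type*} [MeasurableSpace S] {ν : Measure S} {n : ℕ}
    {A : S → Set (Vec n)} {L : S → ℝ} (hL : Integrable L ν)
    (hAL : ∀ᵐ y ∂ν, ∀ g ∈ A y, ‖g‖ ≤ L y) {s : S → Vec n} (hs : Measurable s)
    (hsA : ∀ᵐ y ∂ν, s y ∈ A y) : Integrable s ν := by
  refine hL.mono' hs.aestronglyMeasurable ?_
  filter_upwards [hAL, hsA] with y h1 h2 using h1 _ h2

theorem norm_le_of_mem_aumannIntegral {S : Type*} [MeasurableSpace S] {ν : Measure S} {n : ℕ}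
    {A : S → Set (Vec n)} {L : S → ℝ} (hL : Integrable L ν)
    (hAL : ∀ᵐ y ∂ν, ∀ g ∈ A y, ‖g‖ ≤ L y) {v : Vec n} (hv : v ∈ aumannIntegral ν A) :
    ‖v‖ ≤ ∫ y, L y ∂ν := by
  obtain ⟨s, hs, hsA, -, rfl⟩ := hv
  refine norm_integral_le_of_norm_le hL ?_
  filter_upwards [hAL, hsA] with y h1 h2 using h1 _ h2

theorem convex_aumannIntegral {S : Type*} [MeasurableSpace S] {ν : Measure S} {n : ℕ}
    {A : S → Set (Vec n)} (hA : ∀ᵐ y ∂ν, Convex ℝ (A y)) : Convex ℝ (aumannIntegral ν A) := by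
  rintro _ ⟨s, hs, hsA, hsi, rfl⟩ _ ⟨t, ht, htA, hti, rfl⟩ a b ha hb hab
  refine ⟨fun y => a • s y + b • t y, (hs.const_smul a).add (ht.const_smul b), ?_,
    (hsi.smul a).add (hti.smul b), ?_⟩
  · filter_upwards [hA, hsA, htA] with y h1 h2 h3 using h1 h2 h3 ha hb hab
  · have h1 : Integrable (fun y => a • s y) ν := hsi.smul a
    have h2 : Integrable (fun y => b • t y) ν := hti.smul b
    rw [integral_add h1 h2, integral_smul, integral_smul]

/-- The Aumann integral of upper semicontinuous multifunctions with closed convex values that are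
bounded by an integrable function has a closed graph. -/
theorem mem_aumannIntegral_of_tendsto {S X : Type*} [MeasurableSpace S] [TopologicalSpace X]
    {ν : Measure S} [IsFiniteMeasure ν] {n : ℕ} {D : S → X → Set (Vec n)} {x : X}
    (hD : ∀ᵐ y ∂ν, UpperHemicontinuousAt (D y) x) (hcl : ∀ᵐ y ∂ν, IsClosed (D y x))
    (hcv : ∀ᵐ y ∂ν, Convex ℝ (D y x)) {L : S → ℝ} (hL : Integrable L ν)
    {b : ℕ → X} (hDL : ∀ k, ∀ᵐ y ∂ν, ∀ g ∈ D y (b k), ‖g‖ ≤ L y)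
    (hb : Tendsto b atTop (𝓝 x)) {w : ℕ → Vec n}
    (hw : ∀ k, w k ∈ aumannIntegral ν fun y => D y (b k)) {v : Vec n}
    (hwv : Tendsto w atTop (𝓝 v)) : v ∈ aumannIntegral ν fun y => D y x := by
  choose s hs hsD hsi hsw using hw
  obtain ⟨t, ht, htE, hti, htv⟩ := exists_measurable_integral_eq_of_tendsto
    -- The added 1 makes the weight strictly positive, so that one can divide by it.
    (W := fun y => |L y| + 1) (hL.abs.add (integrable_const 1)) (fun y => by positivity)
    (fun k => (hs k).aestronglyMeasurable)
    (fun k => by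
      filter_upwards [hDL k, hsD k] with y h1 h2
      linarith [h1 _ h2, le_abs_self (L y)])
    (E := fun m y => closure (convexHull ℝ (⋃ k ≥ m, D y (b k))))
    (fun y i j hij => closure_mono (convexHull_mono
      (Set.biUnion_subset_biUnion_left fun k hk => hij.trans hk)))
    (fun _ _ => isClosed_closure) (fun _ _ => (convex_convexHull ℝ _).closure)
    (fun k => by
      filter_upwards [hsD k] with y hy
      exact subset_closure (subset_convexHull ℝ _ (Set.mem_iUnion₂.2 ⟨k, le_refl k, hy⟩)))
    (v := v) (by simpa only [hsw] using hwv)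
  refine ⟨t, ht, ?_, hti, htv⟩
  filter_upwards [hD, hcl, hcv, htE] with y h1 h2 h3 h4
  exact h1.mem_of_forall_mem_closure_convexHull h2 h3 hb h4

theorem isCompact_aumannIntegral {S : Type*} [MeasurableSpace S] {ν : Measure S}
    [IsFiniteMeasure ν] {n : ℕ} {A : S → Set (Vec n)} (hcl : ∀ᵐ y ∂ν, IsClosed (A y))
    (hcv : ∀ᵐ y ∂ν, Convex ℝ (A y)) {L : S → ℝ} (hL : Integrable L ν)
    (hAL : ∀ᵐ y ∂ν, ∀ g ∈ A y, ‖g‖ ≤ L y) : IsCompact (aumannIntegral ν A) := by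
  refine Metric.isCompact_of_isClosed_isBounded (isClosed_of_closure_subset fun v hv => ?_) ?_
  · obtain ⟨w, hw, hwv⟩ := mem_closure_iff_seq_limit.1 hv
    -- Closedness is the closed graph property for a multifunction constant in the parameter.
    exact mem_aumannIntegral_of_tendsto (X := Unit) (D := fun y _ => A y) (x := ())
      (Eventually.of_forall fun y => UpperHemicontinuous.const ()) hcl hcv hL (fun _ => hAL)
      tendsto_const_nhds hw hwv
  · exact isBounded_iff_forall_norm_le.2 ⟨_, fun v hv => norm_le_of_mem_aumannIntegral hL hAL hv⟩

/-! ### Integrals of generalized subdifferentials -/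

section IntegralOfSubdifferentials

variable {S : Type*} [MeasurableSpace S] {ν : Measure S} {n : ℕ} {h : S → Vec n → ℝ}
  {D : S → Vec n → Set (Vec n)} {L : ℕ → S → ℝ}

theorem ae_abs_sub_le_of_isGeneralizedSubdifferential
    (hD : ∀ᵐ y ∂ν, IsGeneralizedSubdifferential (h y) (D y)) {k : ℕ}
    (hDL : ∀ᵐ y ∂ν, ∀ b ∈ Metric.closedBall 0 (k : ℝ), ∀ g ∈ D y b, ‖g‖ ≤ L k y) :
    ∀ᵐ y ∂ν, ∀ a ∈ Metric.closedBall 0 (k : ℝ), ∀ b ∈ Metric.closedBall 0 (k : ℝ),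
      |h y b - h y a| ≤ L k y * ‖b - a‖ := by
  filter_upwards [hD, hDL] with y h1 h2 a ha b hb
  exact h1.abs_sub_le (convex_closedBall 0 _) h2 ha hb

/-- Integrability of a family of generalized differentiable functions at a dense set of parameters
extends to all parameters. -/
theorem integrable_of_isGeneralizedSubdifferential
    (hD : ∀ᵐ y ∂ν, IsGeneralizedSubdifferential (h y) (D y)) (hL : ∀ k, Integrable (L k) ν)
    (hDL : ∀ k : ℕ, ∀ᵐ y ∂ν, ∀ b ∈ Metric.closedBall 0 (k : ℝ), ∀ g ∈ D y b, ‖g‖ ≤ L k y)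
    {Q : Set (Vec n)} (hQ : Dense Q) (hint : ∀ q ∈ Q, Integrable (fun y => h y q) ν)
    (b : Vec n) : Integrable (fun y => h y b) ν := by
  obtain ⟨q, hqQ, hqb⟩ := mem_closure_iff_seq_limit.1 (hQ b)
  obtain ⟨R, hR⟩ := isBounded_iff_forall_norm_le.1 (Metric.isBounded_range_of_tendsto q hqb)
  obtain ⟨k, hk⟩ := exists_nat_ge R
  have hqk : ∀ i, q i ∈ Metric.closedBall (0 : Vec n) k := fun i =>
    mem_closedBall_zero_iff.2 ((hR _ ⟨i, rfl⟩).trans hk)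
  have hbk : b ∈ Metric.closedBall (0 : Vec n) k :=
    Metric.isClosed_closedBall.mem_of_tendsto hqb (Eventually.of_forall hqk)
  have hlip := ae_abs_sub_le_of_isGeneralizedSubdifferential hD (hDL k)
  have hmeas : AEStronglyMeasurable (fun y => h y b) ν := by
    refine aestronglyMeasurable_of_tendsto_ae atTop (fun i => (hint _ (hqQ i)).1) ?_
    filter_upwards [hlip] with y hy
    rw [tendsto_iff_norm_sub_tendsto_zero]
    refine squeeze_zero (fun _ => norm_nonneg _) (fun i => hy b hbk _ (hqk i)) ?_
    simpa using (tendsto_iff_norm_sub_tendsto_zero.1 hqb).const_mul (L k y)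
  have hdiff : Integrable (fun y => h y b - h y (q 0)) ν := by
    refine ((hL k).mul_const ‖b - q 0‖).mono' (hmeas.sub (hint _ (hqQ 0)).1) ?_
    filter_upwards [hlip] with y hy using hy _ (hqk 0) b hbk
  exact (hdiff.add (hint _ (hqQ 0))).congr (Eventually.of_forall fun y => sub_add_cancel _ _)

/-- The Aumann integral of generalized subdifferentials is a generalized subdifferential of the
integral. -/
theorem isGeneralizedSubdifferential_integral [IsFiniteMeasure ν]
    (hDm : ∀ b, MeasurableMultifunction fun y => D y b)
    (hD : ∀ᵐ y ∂ν, IsGeneralizedSubdifferential (h y) (D y)) (hL : ∀ k, Integrable (L k) ν)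
    (hDL : ∀ k : ℕ, ∀ᵐ y ∂ν, ∀ b ∈ Metric.closedBall 0 (k : ℝ), ∀ g ∈ D y b, ‖g‖ ≤ L k y)
    (hint : ∀ b, Integrable (fun y => h y b) ν) :
    IsGeneralizedSubdifferential (fun b => ∫ y, h y b ∂ν)
      (fun b => aumannIntegral ν fun y => D y b) := by
  have hDL' : ∀ k : ℕ, ∀ b ∈ Metric.closedBall (0 : Vec n) (k : ℝ),
      ∀ᵐ y ∂ν, ∀ g ∈ D y b, ‖g‖ ≤ L k y := fun k b hb => (hDL k).mono fun y hy => hy b hb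
  have hball : ∀ b : Vec n, ∃ k : ℕ, b ∈ Metric.closedBall (0 : Vec n) (k : ℝ) := fun b =>
    (exists_nat_ge ‖b‖).imp fun k hk => mem_closedBall_zero_iff.2 hk
  have hseq : ∀ (b : ℕ → Vec n) (x : Vec n), Tendsto b atTop (𝓝 x) → ∃ k : ℕ,
      x ∈ Metric.closedBall (0 : Vec n) (k : ℝ) ∧
        ∀ i, b i ∈ Metric.closedBall (0 : Vec n) (k : ℝ) := by
    intro b x hb
    obtain ⟨R, hR⟩ := isBounded_iff_forall_norm_le.1 (Metric.isBounded_range_of_tendsto b hb)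
    obtain ⟨k, hk⟩ := exists_nat_ge R
    have hbk : ∀ i, b i ∈ Metric.closedBall (0 : Vec n) k := fun i =>
      mem_closedBall_zero_iff.2 ((hR _ ⟨i, rfl⟩).trans hk)
    exact ⟨k, Metric.isClosed_closedBall.mem_of_tendsto hb (Eventually.of_forall hbk), hbk⟩
  refine ⟨fun x => ?_, fun x => ?_, fun x => ?_, ?_, fun x ε hε => ?_⟩
  · obtain ⟨k, hk⟩ := hball x
    obtain ⟨s, hs, hsD⟩ := (hDm x).exists_measurable_ae_selection (μ := ν)
      (hD.mono fun y hy => ⟨hy.nonempty x, (hy.compact x).isClosed, hy.convex x⟩)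
    exact ⟨_, s, hs, hsD, integrable_of_ae_mem_of_norm_le (hL k) (hDL' k x hk) hs hsD, rfl⟩
  · exact convex_aumannIntegral (hD.mono fun y hy => hy.convex x)
  · obtain ⟨k, hk⟩ := hball x
    exact isCompact_aumannIntegral (hD.mono fun y hy => (hy.compact x).isClosed)
      (hD.mono fun y hy => hy.convex x) (hL k) (hDL' k x hk)
  · refine upperHemicontinuous_iff_frequently.2 fun x t ht hfr => ?_
    obtain ⟨b, hb, hbt⟩ := exists_seq_forall_of_frequently hfr
    choose w hwD hwt using hbt
    obtain ⟨k, -, hk⟩ := hseq b x hb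
    have hwb : ∀ i, w i ∈ Metric.closedBall (0 : Vec n) (∫ y, L k y ∂ν) := fun i =>
      mem_closedBall_zero_iff.2 (norm_le_of_mem_aumannIntegral (hL k) (hDL' k _ (hk i)) (hwD i))
    obtain ⟨v, -, φ, hφ, hv⟩ := tendsto_subseq_of_bounded Metric.isBounded_closedBall hwb
    exact ⟨v, mem_aumannIntegral_of_tendsto (hD.mono fun y hy => hy.upperSemicontinuous x)
      (hD.mono fun y hy => (hy.compact x).isClosed) (hD.mono fun y hy => hy.convex x) (hL k)
      (fun i => hDL' k _ (hk (φ i))) (hb.comp hφ.tendsto_atTop) (fun i => hwD (φ i)) hv,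
      ht.mem_of_tendsto hv (Eventually.of_forall fun i => hwt _)⟩
  · by_contra hcon
    obtain ⟨b, hb, hbt⟩ := exists_seq_forall_of_frequently (not_eventually.1 hcon)
    push Not at hbt
    choose w hwD hwt using hbt
    choose s hs hsD hsi hsw using hwD
    obtain ⟨k, hxk, hk⟩ := hseq b x hb
    -- At `b i = x` both sides of the expansion inequality vanish, so it cannot fail there.
    have hbx : ∀ i, 0 < ‖b i - x‖ := by
      intro i
      refine norm_pos_iff.2 fun h0 => ?_
      have := hwt i
      rw [sub_eq_zero.1 h0] at this
      simp at this
    let r : ℕ → S → ℝ := fun i y =>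
      ‖b i - x‖⁻¹ * (h y (b i) - h y x - inner ℝ (s i y) (b i - x))
    have hri : ∀ i, Integrable (r i) ν := fun i =>
      (((hint (b i)).sub (hint x)).sub ((hsi i).inner_const (b i - x))).const_mul _
    have hrint : ∀ i, ∫ y, r i y ∂ν = ‖b i - x‖⁻¹ *
        ((∫ y, h y (b i) ∂ν) - (∫ y, h y x ∂ν) - inner ℝ (w i) (b i - x)) := by
      intro i
      have hin : ∫ y, inner ℝ (s i y) (b i - x) ∂ν = inner ℝ (w i) (b i - x) := by
        rw [← hsw i, real_inner_comm, ← integral_inner (hsi i)]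
        exact integral_congr_ae (Eventually.of_forall fun y => real_inner_comm _ _)
      have hd : Integrable (fun y => h y (b i) - h y x) ν := (hint _).sub (hint _)
      rw [integral_const_mul, integral_sub hd ((hsi i).inner_const _),
        integral_sub (hint _) (hint _), hin]
    have hlip := ae_abs_sub_le_of_isGeneralizedSubdifferential hD (hDL k)
    have hlim : Tendsto (fun i => ∫ y, r i y ∂ν) atTop (𝓝 (∫ _, 0 ∂ν)) := by
      -- One `L` bounds the difference quotient, the other the inner product with the subgradient.
      refine tendsto_integral_of_dominated_convergence (fun y => 2 * L k y) (fun i => (hri i).1)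
        ((hL k).const_mul 2) (fun i => ?_) ?_
      · filter_upwards [hlip, hsD i, hDL k] with y h1 h2 h3
        have h4 := h1 x hxk (b i) (hk i)
        have h5 := (abs_real_inner_le_norm (s i y) (b i - x)).trans
          (mul_le_mul_of_nonneg_right (h3 _ (hk i) _ h2) (norm_nonneg _))
        have h6 := abs_sub (h y (b i) - h y x) (inner ℝ (s i y) (b i - x))
        rw [norm_mul, norm_inv, norm_norm, inv_mul_le_iff₀ (hbx i), Real.norm_eq_abs]
        linarith
      · have hsD' : ∀ᵐ y ∂ν, ∀ i, s i y ∈ D y (b i) := ae_all_iff.2 hsD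
        filter_upwards [hD, hsD'] with y h1 h2
        rw [tendsto_zero_iff_norm_tendsto_zero]
        refine tendsto_order.2 ⟨fun a ha => Eventually.of_forall fun i => ha.trans_le
          (norm_nonneg _), fun a ha => ?_⟩
        filter_upwards [hb.eventually (h1.expansion x (a / 2) (half_pos ha))] with i hi
        have h3 := hi _ (h2 i)
        rw [norm_mul, norm_inv, norm_norm, Real.norm_eq_abs, inv_mul_lt_iff₀ (hbx i)]
        have := mul_pos ha (hbx i)
        linarith
    rw [integral_zero] at hlim
    obtain ⟨i, hi⟩ := (hlim.norm.eventually_lt_const (by simpa using hε)).exists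
    rw [hrint, norm_mul, norm_inv, norm_norm, Real.norm_eq_abs, inv_mul_lt_iff₀ (hbx i)] at hi
    have := hwt i
    linarith

end IntegralOfSubdifferentials

/-- Approximation by a countable dense set makes this measurable, as needed to transfer "a.s. in ω"
to the joint law. The closure costs nothing, since almost all values are closed. -/
theorem MeasurableMultifunction.measurableSet_mem_closure {S : Type*} [MeasurableSpace S] {n : ℕ}
    {D : S → Set (Vec n)} (hD : MeasurableMultifunction D) {s : S → Vec n} (hs : Measurable s) :
    MeasurableSet {p | s p ∈ closure (D p)} := by
  obtain ⟨Q, hQc, hQd⟩ := TopologicalSpace.exists_countable_dense (Vec n)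
  have : {p | s p ∈ closure (D p)} = ⋂ m : ℕ, ⋃ z ∈ Q,
      s ⁻¹' Metric.ball z (1 / ((m : ℝ) + 1)) ∩
        {p | (D p ∩ Metric.ball z (1 / ((m : ℝ) + 1))).Nonempty} := by
    ext p
    simp only [Set.mem_ofPred_eq, Set.mem_iInter, Set.mem_iUnion, exists_prop, Set.mem_inter_iff,
      Set.mem_preimage]
    constructor
    · intro hp m
      have hm : (0 : ℝ) < 1 / ((m : ℝ) + 1) := by positivity
      obtain ⟨z, hz, hzp⟩ := hQd.exists_dist_lt (s p) hm
      have hzp' : s p ∈ Metric.ball z (1 / ((m : ℝ) + 1)) := hzp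
      exact ⟨z, hz, hzp', by
        rw [Set.inter_comm]; exact mem_closure_iff.1 hp _ Metric.isOpen_ball hzp'⟩
    · intro hp
      refine Metric.mem_closure_iff.2 fun ε hε => ?_
      obtain ⟨m, hm⟩ := exists_nat_one_div_lt (half_pos hε)
      obtain ⟨z, -, hz, w, hw, hwz⟩ := hp m
      refine ⟨w, hw, ?_⟩
      have h1 := dist_triangle_right (s p) w z
      rw [Metric.mem_ball] at hz hwz
      linarith
  rw [this]
  exact MeasurableSet.iInter fun m => MeasurableSet.biUnion hQc fun z _ =>
    (hs Metric.isOpen_ball.measurableSet).inter (hD _ Metric.isOpen_ball)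

/-! ### Disintegration and the main theorem -/

/-- `D x y β j` is the generalized subdifferential of `f_j(x, y, ·)` at `β`. -/
theorem mainTheorem5 {Ω : Type*} [MeasurableSpace Ω] (P : Measure Ω) [IsProbabilityMeasure P]
    {nx ny nb nf : ℕ} (X : Ω → Vec nx) (Y : Ω → Vec ny) (hX : Measurable X) (hY : Measurable Y)
    (f : Vec nx → Vec ny → Vec nb → Vec nf)
    (D : Vec nx → Vec ny → Vec nb → Fin nf → Set (Vec nb))
    -- `f(X, Y, β)` is integrable for every `β`
    (hf : ∀ β, Integrable (fun p : Vec nx × Vec ny => f p.1 p.2 β) (P.map fun ω => (X ω, Y ω)))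
    -- the subdifferentials depend measurably on `(x, y)`
    (hDmeas : ∀ β j, MeasurableMultifunction (fun p : Vec nx × Vec ny => D p.1 p.2 β j))
    -- `f(X, Y, ·)` is differentiable in the generalized sense
    (hD : ∀ᵐ p ∂(P.map fun ω => (X ω, Y ω)),
      IsGeneralizedSubdifferentialVec (f p.1 p.2) (D p.1 p.2))
    -- subgradients are bounded by an integrable function near every point
    (hbound : ∀ β₀ : Vec nb, ∀ K ∈ 𝓝 β₀, Bornology.IsBounded K →
      ∃ L : Vec nx × Vec ny → ℝ, Integrable L (P.map fun ω => (X ω, Y ω)) ∧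
        ∀ᵐ p ∂(P.map fun ω => (X ω, Y ω)),
          ∀ β ∈ K, ∀ j, ∀ g ∈ D p.1 p.2 β j, ‖g‖ ≤ L p) :
    -- `F(X, β)` is a version of `𝔼[f(X, Y, β) | X]`
    (∀ β, P[fun ω => f (X ω) (Y ω) β | MeasurableSpace.comap X inferInstance]
      =ᵐ[P] fun ω => condMean (condDistrib Y X P) f (X ω) β) ∧
    -- for almost all `x`, it is well defined and differentiable in the generalized sense in `β`
    (∀ᵐ x ∂(P.map X),
      (∀ β, Integrable (fun y => f x y β) (condDistrib Y X P x)) ∧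
      IsGeneralizedSubdifferentialVec (condMean (condDistrib Y X P) f x)
        (condSubdifferential (condDistrib Y X P) D x)) ∧
    -- conditional expectations of measurable selections are generalized subgradients
    (∀ (β : Vec nb) (s : Vec nx × Vec ny → Fin nf → Vec nb), Measurable s →
      (∀ᵐ ω ∂P, s (X ω, Y ω) ∈ jacobianSet (D (X ω) (Y ω) β)) →
      Integrable (fun ω => s (X ω, Y ω)) P ∧
      ∀ᵐ ω ∂P, (P[fun ω' => s (X ω', Y ω') | MeasurableSpace.comap X inferInstance]) ω ∈
        jacobianSet (condSubdifferential (condDistrib Y X P) D (X ω) β)) := by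

  have hXY : AEMeasurable (fun ω => (X ω, Y ω)) P := (hX.prodMk hY).aemeasurable
  have hdis : ∀ {q : Vec nx × Vec ny → Prop}, (∀ᵐ p ∂(P.map fun ω => (X ω, Y ω)), q p) →
      ∀ᵐ x ∂(P.map X), ∀ᵐ y ∂(condDistrib Y X P x), q (x, y) := by
    intro q hq
    rw [← compProd_map_condDistrib hY.aemeasurable] at hq
    exact Measure.ae_ae_of_ae_compProd hq
  -- The extra 1 keeps the ball a neighbourhood of 0 even for `k = 0`.
  choose L hL hDL using fun k : ℕ => hbound 0 (Metric.closedBall 0 ((k : ℝ) + 1))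
    (Metric.closedBall_mem_nhds 0 (by positivity)) Metric.isBounded_closedBall
  replace hDL : ∀ k : ℕ, ∀ᵐ p ∂(P.map fun ω => (X ω, Y ω)),
      ∀ β ∈ Metric.closedBall (0 : Vec nb) (k : ℝ), ∀ j, ∀ g ∈ D p.1 p.2 β j, ‖g‖ ≤ L k p :=
    fun k => (hDL k).mono fun p hp β hβ =>
      hp β (Metric.closedBall_subset_closedBall (by linarith) hβ)
  refine ⟨fun β => condExp_prod_ae_eq_integral_condDistrib' hX hY.aemeasurable (hf β), ?_, ?_⟩
  -- Each β has its own exceptional null set of x; a countable dense set of β gives a common one,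
  -- and the Lipschitz bounds extend integrability to every β.
  · obtain ⟨Q, hQc, hQd⟩ := TopologicalSpace.exists_countable_dense (Vec nb)
    filter_upwards [hdis hD,
      ae_all_iff.2 fun k => (hL k).condDistrib_ae_map hY.aemeasurable,
      ae_all_iff.2 fun k => hdis (hDL k),
      (ae_ball_iff hQc).2 fun q _ => (hf q).condDistrib_ae_map hY.aemeasurable]
      with x hDx hLx hDLx hfx
    have hDx' : ∀ j, ∀ᵐ y ∂(condDistrib Y X P x),
        IsGeneralizedSubdifferential (fun β => f x y β j) (fun β => D x y β j) :=
      fun j => hDx.mono fun y hy => hy j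
    have hDLx' : ∀ j, ∀ k : ℕ, ∀ᵐ y ∂(condDistrib Y X P x),
        ∀ β ∈ Metric.closedBall (0 : Vec nb) (k : ℝ), ∀ g ∈ D x y β j, ‖g‖ ≤ L k (x, y) :=
      fun j k => (hDLx k).mono fun y hy β hβ => hy β hβ j
    have hcomp : ∀ j β, Integrable (fun y => f x y β j) (condDistrib Y X P x) := fun j =>
      integrable_of_isGeneralizedSubdifferential (hDx' j) hLx (hDLx' j) hQd
        fun q hq => (hfx q hq).eval_piLp j
    refine ⟨fun β => Integrable.of_eval_piLp fun j => hcomp j β, fun j => ?_⟩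
    have hmean : (fun β => condMean (condDistrib Y X P) f x β j) =
        fun β => ∫ y, f x y β j ∂(condDistrib Y X P x) :=
      funext fun β => eval_integral_piLp (fun i => hcomp i β) j
    rw [hmean]
    exact isGeneralizedSubdifferential_integral
      (fun β U hU => measurable_prodMk_left (hDmeas β j U hU)) (hDx' j) hLx (hDLx' j) (hcomp j)
  · intro β s hs hsD
    have hsj : ∀ j, Measurable fun p => s p j := fun j => (measurable_pi_apply j).comp hs
    have hsD' : ∀ᵐ p ∂(P.map fun ω => (X ω, Y ω)), ∀ j, s p j ∈ D p.1 p.2 β j := by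
      refine ae_all_iff.2 fun j => ?_
      have hcl : ∀ᵐ p ∂(P.map fun ω => (X ω, Y ω)), s p j ∈ closure (D p.1 p.2 β j) :=
        (ae_map_iff hXY ((hDmeas β j).measurableSet_mem_closure (hsj j))).2
          (hsD.mono fun ω hω => subset_closure (hω j))
      filter_upwards [hcl, hD] with p hp hpD
      rwa [((hpD j).compact β).isClosed.closure_eq] at hp
    obtain ⟨k, hk⟩ := exists_nat_ge ‖β‖
    have hβk : β ∈ Metric.closedBall (0 : Vec nb) (k : ℝ) := mem_closedBall_zero_iff.2 hk
    have hsint : Integrable s (P.map fun ω => (X ω, Y ω)) := Integrable.of_eval fun j =>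
      integrable_of_ae_mem_of_norm_le (A := fun p => D p.1 p.2 β j) (hL k)
        ((hDL k).mono fun p hp => hp β hβk j) (hsj j) (hsD'.mono fun p hp => hp j)
    refine ⟨hsint.comp_aemeasurable hXY, ?_⟩
    filter_upwards [condExp_prod_ae_eq_integral_condDistrib' hX hY.aemeasurable hsint,
      ae_of_ae_map hX.aemeasurable (hdis hsD'),
      hsint.condDistrib_ae hX.aemeasurable hY.aemeasurable] with ω h1 h2 h3 j
    rw [h1]
    exact ⟨fun y => s (X ω, y) j, (hsj j).comp measurable_prodMk_left, h2.mono fun y hy => hy j,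
      h3.eval j, (eval_integral (fun i => h3.eval i) j).symm⟩
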